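/- For every $n \in \mathbb{N}$ let $\mathscr{S}_n$ be a finite set of unordered pairs $\{i,j\}$ with $i \neq j$, let $T_n = \bigcup_{\{i,j\} \in \mathscr{S}_n} \{i,j\}$, and let $(D_{n,\{i,j\}})_{\{i,j\} \in \mathscr{S}_n}$ be $\{0,1\}$-valued random variables on a probability space (which may depend on $n$). Assume that for every $n$ these variables are dissociated: whenever $\mathscr{A}, \mathscr{B} \subseteq \mathscr{S}_n$ satisfy $\big(\bigcup_{\{i,j\} \in \mathscr{A}} \{i,j\}\big) \cap \big(\bigcup_{\{i,j\} \in \mathscr{B}} \{i,j\}\big) = \varnothing$, the families $(D_{n,\{i,j\}})_{\{i,j\} \in \mathscr{A}}$ and $(D_{n,\{i,j\}})_{\{i,j\} \in \mathscr{B}}$ are independent. Let $\lambda \geq 0$ and suppose that, as $n \to \infty$, $$\mathbb{E}\Big(\sum_{\{i,j\} \in \mathscr{S}_n} D_{n,\{i,j\}}\Big) \to \lambda, \qquad \mathbb{V}\Big(\sum_{\{i,j\} \in \mathscr{S}_n} D_{n,\{i,j\}}\Big) \to \lambda,$$ $$|T_n| \sum_{\{i,j\} \in \mathscr{S}_n}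 \big(\mathbb{E}(D_{n,\{i,j\}})\big)^2 \to 0, \qquad \sum_{i \in T_n} \ \sum_{j \in T_n \setminus \{i\}} \ \sum_{k \in T_n \setminus \{i,j\}} \mathbb{E}\big(D_{n,\{i,j\}} D_{n,\{i,k\}}\big) \to 0,$$ where $\mathbb{V}$ denotes the variance and, in the last sum, $D_{n,\{i,j\}}$ is taken to be $0$ if $\{i,j\} \notin \mathscr{S}_n$. Then $\sum_{\{i,j\} \in \mathscr{S}_n} D_{n,\{i,j\}}$ converges in distribution to the Poisson distribution $\mathrm{Poi}(\lambda)$ (the point mass at $0$ if $\lambda = 0$). -/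

import Mathlib

open MeasureTheory ProbabilityTheory Filter
open scoped Topology NNReal

/-- The union of the pairs `{i, j}` in a finite family `S` of unordered pairs. -/
def pairSupport {V : Type*} [DecidableEq V] (S : Finset (Sym2 V)) : Finset V :=
  S.biUnion Sym2.toFinset

/-- The random variables `D e`, for `e ∈ S`, are dissociated: the subfamilies indexed by `A ⊆ S` and
`B ⊆ S` are independent whenever no index occurs both in a pair of `A` and in a pair of `B`. -/
def Dissociated {Ω V : Type*} [MeasurableSpace Ω] [DecidableEq V] (P : Measure Ω)
    (S : Finset (Sym2 V)) (D : Sym2 V → Ω → ℝ) : Prop :=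
  ∀ A B : Finset (Sym2 V), A ⊆ S → B ⊆ S → Disjoint (pairSupport A) (pairSupport B) →
    IndepFun (fun ω (e : A) => D e ω) (fun ω (e : B) => D e ω) P

/-- The sum of `E (D {i, j} * D {i, k})` over pairwise distinct `i`, `j`, `k` in the union of the
pairs of `S`, where `D {i, j}` counts as `0` if the pair `{i, j}` is not in `S`. -/
noncomputable def adjacentPairSum {Ω V : Type*} [MeasurableSpace Ω] [DecidableEq V] (P : Measure Ω)
    (S : Finset (Sym2 V)) (D : Sym2 V → Ω → ℝ) : ℝ :=
  ∑ i ∈ pairSupport S, ∑ j ∈ pairSupport S \ {i}, ∑ k ∈ pairSupport S \ {i, j},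
    if s(i, j) ∈ S ∧ s(i, k) ∈ S then ∫ ω, D s(i, j) ω * D s(i, k) ω ∂P else 0

/-! Stein's method through characteristic functions. Let `W` be the sum of the indicators and `φ`
its characteristic function, so `φ' t = i ∑ E(D e · exp(itW))`. Split `W = N + R`, with `N` the sum
over pairs meeting `e` (including `e`); by dissociation `R` is independent of `D e`. Where `D e =
1`, `W` is `1 + R` up to the other summands of `N`, so the `e`-term is nearly `E(D e) exp(it) φ t`,
and `φ` almost solves the Poisson equation `φ' = i r exp(it) φ`, `r = E W`.

The error is at most `|t|` times the adjacent pair sum plus `∑ E(D e) E(N)`, and the latter is at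
most `2 |T| ∑ E(D e)²`. Integrating the equation bounds the distance to the Poisson characteristic
function of mean `r`; letting `r → λ`, Lévy's continuity theorem concludes. -/

open Complex in
/-- A `C¹` function on `ℝ` with `f 0 = 1` that almost solves the differential equation of the
characteristic function of the Poisson law of mean `r` is close to this characteristic function. -/
lemma norm_sub_exp_le_of_hasDerivAt {f f' : ℝ → ℂ} {r c : ℝ} (hr : 0 ≤ r) (hc : 0 ≤ c)
    (h0 : f 0 = 1) (hf : ∀ t, HasDerivAt f (f' t) t)
    (hb : ∀ t, ‖f' t - r * I * cexp (t * I) * f t‖ ≤ c * |t|) (t : ℝ) :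
    ‖f t - cexp (r * (cexp (t * I) - 1))‖ ≤ Real.exp (2 * r) * c * |t| * |t| := by
  have hre (s : ℝ) : (r * (cexp (s * I) - 1) : ℂ).re = r * (Real.cos s - 1) := by
    rw [re_ofReal_mul, sub_re, exp_ofReal_mul_I_re, one_re]
  -- Integrating factor: dividing by the exact solution leaves only the defect in the derivative.
  have hder (s : ℝ) : HasDerivAt (fun s : ℝ => f s * cexp (-(r * (cexp (s * I) - 1))))
      ((f' s - r * I * cexp (s * I) * f s) * cexp (-(r * (cexp (s * I) - 1)))) s := by
    have h1 : HasDerivAt (fun s : ℝ => (s : ℂ) * I) (1 * I) s :=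
      (hasDerivAt_id s).ofReal_comp.mul_const I
    have h2 := (((h1.cexp.sub_const 1).const_mul (r : ℂ)).fun_neg).cexp
    convert! (hf s).fun_mul h2 using 1
    ring
  have hbound (s : ℝ) (hs : s ∈ Set.uIcc 0 t) :
      ‖(f' s - r * I * cexp (s * I) * f s) * cexp (-(r * (cexp (s * I) - 1)))‖
        ≤ c * |t| * Real.exp (2 * r) := by
    rw [norm_mul, norm_exp, neg_re, hre]
    have hst : |s| ≤ |t| := by simpa using Set.abs_sub_left_of_mem_uIcc hs
    gcongr
    · exact (hb s).trans (by gcongr)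
    -- The integrating factor has modulus `exp (r (1 - cos s)) ≤ exp (2 r)`.
    · nlinarith [Real.neg_one_le_cos s]
  have key := (convex_uIcc 0 t).norm_image_sub_le_of_norm_hasDerivWithin_le
    (fun s _ => (hder s).hasDerivWithinAt) hbound Set.left_mem_uIcc Set.right_mem_uIcc
  simp only [h0, ofReal_zero, zero_mul, exp_zero, sub_self, mul_zero, neg_zero, mul_one, sub_zero,
    Real.norm_eq_abs] at key
  have hle : ‖cexp (r * (cexp (t * I) - 1))‖ ≤ 1 := by
    rw [norm_exp, hre, Real.exp_le_one_iff]
    nlinarith [Real.cos_le_one t]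
  have heq : f t - cexp (r * (cexp (t * I) - 1))
      = (f t * cexp (-(r * (cexp (t * I) - 1))) - 1) * cexp (r * (cexp (t * I) - 1)) := by
    rw [sub_mul, mul_assoc, ← Complex.exp_add, neg_add_cancel, Complex.exp_zero, mul_one, one_mul]
  rw [heq, norm_mul]
  calc _ ≤ (c * |t| * Real.exp (2 * r) * |t|) * 1 := by gcongr
    _ = _ := by ring

lemma norm_cexp_mul_I_sub_le (x y : ℝ) :
    ‖Complex.exp (x * Complex.I) - Complex.exp (y * Complex.I)‖ ≤ |x - y| := by
  have h : Complex.exp (x * Complex.I) - Complex.exp (y * Complex.I)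
      = Complex.exp (y * Complex.I) * (Complex.exp (Complex.I * (x - y : ℝ)) - 1) := by
    rw [mul_sub, ← Complex.exp_add, mul_one]
    push_cast
    ring_nf
  rw [h, norm_mul, Complex.norm_exp_ofReal_mul_I, one_mul]
  exact Real.norm_exp_I_mul_ofReal_sub_one_le

/-! ### Counting intersecting pairs -/

section Combinatorics

variable {V : Type*} [DecidableEq V]

/-- The pairs of `S` that meet the pair `e`. -/
def meetingPairs (S : Finset (Sym2 V)) (e : Sym2 V) : Finset (Sym2 V) :=
  S.filter fun f => ¬ Disjoint e.toFinset f.toFinset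

lemma mem_meetingPairs {S : Finset (Sym2 V)} {e f : Sym2 V} :
    f ∈ meetingPairs S e ↔ f ∈ S ∧ ¬ Disjoint e.toFinset f.toFinset :=
  Finset.mem_filter

lemma mem_meetingPairs_self {S : Finset (Sym2 V)} {e : Sym2 V} (he : e ∈ S) :
    e ∈ meetingPairs S e := by
  simp [mem_meetingPairs, he, Sym2.toFinset_ne_empty]

lemma toFinset_subset_pairSupport {S : Finset (Sym2 V)} {e : Sym2 V} (he : e ∈ S) :
    e.toFinset ⊆ pairSupport S :=
  Finset.subset_biUnion_of_mem Sym2.toFinset he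

/-- A pair meeting `e` is determined by a common element, at most two choices, and its other
element. -/
lemma card_meetingPairs_le (S : Finset (Sym2 V)) (e : Sym2 V) :
    (meetingPairs S e).card ≤ 2 * (pairSupport S).card := by
  have hsub : meetingPairs S e ⊆
      (e.toFinset ×ˢ pairSupport S).image fun p => s(p.1, p.2) := by
    intro f hf
    obtain ⟨hfS, hef⟩ := mem_meetingPairs.1 hf
    obtain ⟨i, hi, hi'⟩ := Finset.not_disjoint_iff.1 hef
    obtain ⟨j, rfl⟩ := Sym2.mem_toFinset.1 hi'
    refine Finset.mem_image.2 ⟨(i, j), Finset.mem_product.2 ⟨hi, ?_⟩, rfl⟩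
    exact toFinset_subset_pairSupport hfS (by simp)
  refine (Finset.card_le_card hsub).trans (Finset.card_image_le.trans ?_)
  rw [Finset.card_product]
  gcongr
  rw [Sym2.card_toFinset]
  split_ifs <;> omega

/-- Use `ab ≤ (a² + b²) / 2`; since meeting is symmetric, both squares contribute equally. -/
lemma sum_sum_meetingPairs_mul_le (S : Finset (Sym2 V)) (p : Sym2 V → ℝ) :
    ∑ e ∈ S, ∑ f ∈ meetingPairs S e, p e * p f
      ≤ 2 * ((pairSupport S).card * ∑ e ∈ S, p e ^ 2) := by
  have hswap : ∑ e ∈ S, ∑ f ∈ meetingPairs S e, p f ^ 2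
      = ∑ e ∈ S, ∑ f ∈ meetingPairs S e, p e ^ 2 := by
    refine Finset.sum_comm' fun e f => ?_
    simp only [mem_meetingPairs, disjoint_comm (a := e.toFinset)]
    tauto
  calc ∑ e ∈ S, ∑ f ∈ meetingPairs S e, p e * p f
      ≤ ∑ e ∈ S, ∑ f ∈ meetingPairs S e, (p e ^ 2 + p f ^ 2) / 2 := by
        gcongr with e _ f _
        nlinarith [sq_nonneg (p e - p f)]
    _ = ∑ e ∈ S, ∑ f ∈ meetingPairs S e, p e ^ 2 := by
        simp_rw [← Finset.sum_div, Finset.sum_add_distrib]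
        rw [hswap]
        ring
    _ ≤ ∑ e ∈ S, (2 * (pairSupport S).card) * p e ^ 2 := by
        gcongr with e _
        rw [Finset.sum_const, nsmul_eq_mul]
        gcongr
        exact_mod_cast card_meetingPairs_le S e
    _ = _ := by rw [← Finset.mul_sum]; ring

/-- Two distinct meeting pairs have the form `{i, j}`, `{i, k}` with `i`, `j`, `k` distinct. As `g`
is nonnegative, covering each such couple at least once suffices. -/
lemma sum_sum_meetingPairs_erase_le {S : Finset (Sym2 V)} (hS : ∀ e ∈ S, ¬ e.IsDiag)
    {g : Sym2 V → Sym2 V → ℝ} (hg : ∀ e ∈ S, ∀ f ∈ S, 0 ≤ g e f) :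
    ∑ e ∈ S, ∑ f ∈ (meetingPairs S e).erase e, g e f
      ≤ ∑ i ∈ pairSupport S, ∑ j ∈ pairSupport S \ {i}, ∑ k ∈ pairSupport S \ {i, j},
        if s(i, j) ∈ S ∧ s(i, k) ∈ S then g s(i, j) s(i, k) else 0 := by
  set T := pairSupport S
  let h : (_ : (_ : V) × V) × V → (_ : Sym2 V) × Sym2 V :=
    fun x => ⟨s(x.1.1, x.1.2), s(x.1.1, x.2)⟩
  let A := (S.sigma fun e => (meetingPairs S e).erase e)
  let B := (((T.sigma fun i => T \ {i}).sigma fun x => T \ {x.1, x.2}).filter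
    fun x => s(x.1.1, x.1.2) ∈ S ∧ s(x.1.1, x.2) ∈ S)
  have hAB : A ⊆ B.image h := by
    rintro ⟨e, f⟩ hef
    simp only [A, Finset.mem_sigma, Finset.mem_erase, mem_meetingPairs] at hef
    obtain ⟨he, hne, hf, hd⟩ := hef
    obtain ⟨i, hi, hi'⟩ := Finset.not_disjoint_iff.1 hd
    obtain ⟨j, rfl⟩ := Sym2.mem_toFinset.1 hi
    obtain ⟨k, rfl⟩ := Sym2.mem_toFinset.1 hi'
    have hij : i ≠ j := by simpa using hS _ he
    have hik : i ≠ k := by simpa using hS _ hf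
    have hjk : k ≠ j := by rintro rfl; exact hne rfl
    refine Finset.mem_image.2 ⟨⟨⟨i, j⟩, k⟩, ?_, rfl⟩
    simp only [B, Finset.mem_filter, Finset.mem_sigma, Finset.mem_sdiff, Finset.mem_insert,
      Finset.mem_singleton, not_or]
    exact ⟨⟨⟨toFinset_subset_pairSupport he (by simp), toFinset_subset_pairSupport he (by simp),
      hij.symm⟩, toFinset_subset_pairSupport hf (by simp), hik.symm, hjk⟩, he, hf⟩
  have hB : ∀ x ∈ B, 0 ≤ g (h x).1 (h x).2 := fun x hx =>
    hg _ (Finset.mem_filter.1 hx).2.1 _ (Finset.mem_filter.1 hx).2.2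
  calc _ = ∑ x ∈ A, g x.1 x.2 := (Finset.sum_sigma _ _ _).symm
    _ ≤ ∑ x ∈ B.image h, g x.1 x.2 := by
        refine Finset.sum_le_sum_of_subset_of_nonneg hAB fun x hx _ => ?_
        obtain ⟨y, hy, rfl⟩ := Finset.mem_image.1 hx
        exact hB y hy
    _ ≤ ∑ x ∈ B, g (h x).1 (h x).2 := by
        rw [← Finset.sum_fiberwise_of_maps_to (t := B.image h) (g := h)
          fun x hx => Finset.mem_image_of_mem h hx]
        refine Finset.sum_le_sum fun y hy => ?_
        obtain ⟨x, hx, rfl⟩ := Finset.mem_image.1 hy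
        exact Finset.single_le_sum (f := fun x => g (h x).1 (h x).2)
          (fun z hz => hB z (Finset.mem_filter.1 hz).1) (Finset.mem_filter.2 ⟨hx, rfl⟩)
    _ = _ := by
        rw [Finset.sum_filter, Finset.sum_sigma, Finset.sum_sigma]

end Combinatorics

/-! ### Estimates on one probability space -/

section OneSpace

variable {Ω V : Type*} [MeasurableSpace Ω] [DecidableEq V] {P : Measure Ω}
  {S : Finset (Sym2 V)} {D : Sym2 V → Ω → ℝ}

lemma integrable_of_eq_zero_or_one [IsFiniteMeasure P] {X : Ω → ℝ} (hX : Measurable X)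
    (h : ∀ ω, X ω = 0 ∨ X ω = 1) : Integrable X P := by
  refine Integrable.of_bound hX.aestronglyMeasurable 1 (Eventually.of_forall fun ω => ?_)
  rcases h ω with h | h <;> simp [h]

lemma integrable_mul_of_eq_zero_or_one [IsFiniteMeasure P] {X Y : Ω → ℝ} (hX : Measurable X)
    (hY : Measurable Y) (h : ∀ ω, X ω = 0 ∨ X ω = 1) (h' : ∀ ω, Y ω = 0 ∨ Y ω = 1) :
    Integrable (fun ω => X ω * Y ω) P := by
  refine integrable_of_eq_zero_or_one (hX.mul hY) fun ω => ?_
  rcases h ω with h | h <;> rcases h' ω with h' | h' <;> simp [h, h']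

lemma Dissociated.indepFun_sum (hdiss : Dissociated P S D) {e : Sym2 V} (he : e ∈ S) :
    IndepFun (D e) (fun ω => ∑ f ∈ S \ meetingPairs S e, D f ω) P := by
  have hd : Disjoint (pairSupport {e}) (pairSupport (S \ meetingPairs S e)) := by
    rw [pairSupport, Finset.singleton_biUnion, pairSupport, Finset.disjoint_biUnion_right]
    intro f hf
    rw [Finset.mem_sdiff, mem_meetingPairs] at hf
    tauto
  have h := hdiss {e} (S \ meetingPairs S e) (by simpa using he) Finset.sdiff_subset hd
  have h' := h.comp (measurable_pi_apply ⟨e, Finset.mem_singleton_self e⟩)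
    (ψ := fun x => ∑ f, x f) (by fun_prop)
  convert! h' using 1
  ext ω
  exact (Finset.sum_coe_sort (S \ meetingPairs S e) fun f => D f ω).symm

open Complex in
lemma hasDerivAt_integral_cexp_mul_I [IsFiniteMeasure P] {W : Ω → ℝ} (hW : Measurable W) {C : ℝ}
    (hC : ∀ ω, |W ω| ≤ C) (t : ℝ) :
    HasDerivAt (fun t : ℝ => ∫ ω, cexp ((t * W ω : ℝ) * I) ∂P)
      (∫ ω, I * (W ω * cexp ((t * W ω : ℝ) * I)) ∂P) t := by
  refine (hasDerivAt_integral_of_dominated_loc_of_deriv_le (s := Set.univ) (bound := fun _ => C)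
    (F' := fun t ω => I * (W ω * cexp ((t * W ω : ℝ) * I))) univ_mem
    (Eventually.of_forall fun s => ?_) ?_ ?_ (Eventually.of_forall fun ω s _ => ?_)
    (integrable_const C) (Eventually.of_forall fun ω s _ => ?_)).2
  · exact Measurable.aestronglyMeasurable (by fun_prop)
  · exact Integrable.of_bound (Measurable.aestronglyMeasurable (by fun_prop)) 1
      (Eventually.of_forall fun ω => (norm_exp_ofReal_mul_I _).le)
  · exact Measurable.aestronglyMeasurable (by fun_prop)
  · rw [norm_mul, norm_mul, norm_exp_ofReal_mul_I, norm_I, one_mul, mul_one, norm_real]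
    exact hC ω
  · have h1 : HasDerivAt (fun s : ℝ => ((s * W ω : ℝ) : ℂ) * I) (((1 * W ω : ℝ) : ℂ) * I) s :=
      (((hasDerivAt_id s).mul_const (W ω)).ofReal_comp).mul_const I
    convert! h1.cexp using 1
    push_cast
    ring

-- `W` is replaced by `1 + R` where `X = 1`, independence factors the expectation, and `R` is
-- replaced by `W` again. The two replacements cost `E(X M) |t|` and `E(X) E(N) |t|`.
open Complex in
lemma norm_integral_mul_cexp_sub_le [IsProbabilityMeasure P] {X N M R W : Ω → ℝ}
    (hX : Measurable X) (hX01 : ∀ ω, X ω = 0 ∨ X ω = 1)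
    (hR : Measurable R) (hW : Measurable W) (hind : IndepFun X R P)
    (hN : Integrable N P) (hN0 : ∀ ω, 0 ≤ N ω) (hM0 : ∀ ω, 0 ≤ M ω)
    (hXM : Integrable (fun ω => X ω * M ω) P)
    (hWN : ∀ ω, W ω = N ω + R ω) (hNM : ∀ ω, N ω = X ω + M ω) (t : ℝ) :
    ‖∫ ω, X ω * cexp ((t * W ω : ℝ) * I) ∂P
        - (∫ ω, X ω ∂P : ℝ) * cexp (t * I) * ∫ ω, cexp ((t * W ω : ℝ) * I) ∂P‖
      ≤ (∫ ω, X ω * M ω ∂P + (∫ ω, X ω ∂P) * ∫ ω, N ω ∂P) * |t| := by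
  have hXle (ω : Ω) : 0 ≤ X ω ∧ X ω ≤ 1 := by rcases hX01 ω with h | h <;> simp [h]
  have hEW : Integrable (fun ω => cexp ((t * W ω : ℝ) * I)) P :=
    Integrable.of_bound (Measurable.aestronglyMeasurable (by fun_prop)) 1
      (Eventually.of_forall fun ω => (norm_exp_ofReal_mul_I _).le)
  have hER : Integrable (fun ω => cexp ((t * R ω : ℝ) * I)) P :=
    Integrable.of_bound (Measurable.aestronglyMeasurable (by fun_prop)) 1
      (Eventually.of_forall fun ω => (norm_exp_ofReal_mul_I _).le)
  have hXE {Y : Ω → ℝ} (hY : Measurable Y) :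
      Integrable (fun ω => (X ω : ℂ) * cexp ((t * Y ω : ℝ) * I)) P := by
    refine Integrable.of_bound (Measurable.aestronglyMeasurable (by fun_prop)) 1
      (Eventually.of_forall fun ω => ?_)
    rw [norm_mul, norm_exp_ofReal_mul_I, mul_one, norm_real, Real.norm_of_nonneg (hXle ω).1]
    exact (hXle ω).2
  have hprod : ∫ ω, (X ω : ℂ) * cexp ((t * R ω : ℝ) * I) ∂P
      = (∫ ω, X ω ∂P : ℝ) * ∫ ω, cexp ((t * R ω : ℝ) * I) ∂P := by
    rw [← integral_complex_ofReal]
    exact hind.integral_fun_comp_mul_comp (f := fun x : ℝ => (x : ℂ))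
      (g := fun x : ℝ => cexp ((t * x : ℝ) * I)) hX.aemeasurable hR.aemeasurable
      (Measurable.aestronglyMeasurable (by fun_prop)) (Measurable.aestronglyMeasurable (by fun_prop))
  have h1 : ‖∫ ω, X ω * cexp ((t * W ω : ℝ) * I) ∂P
      - cexp (t * I) * ∫ ω, (X ω : ℂ) * cexp ((t * R ω : ℝ) * I) ∂P‖
      ≤ (∫ ω, X ω * M ω ∂P) * |t| := by
    rw [← integral_const_mul, ← integral_sub (hXE hW) ((hXE hR).const_mul _),
      ← integral_mul_const]
    refine norm_integral_le_of_norm_le (hXM.mul_const _) (Eventually.of_forall fun ω => ?_)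
    -- Both integrands vanish if `X = 0`; if `X = 1`, the two phases differ by `t * M`.
    rcases hX01 ω with h | h
    · simp [h]
    · have := norm_cexp_mul_I_sub_le (t * W ω) (t + t * R ω)
      rw [show t * W ω - (t + t * R ω) = M ω * t by rw [hWN, hNM, h]; ring, abs_mul,
        abs_of_nonneg (hM0 ω)] at this
      simpa [h, add_mul, Complex.exp_add] using this
  have h2 : ‖∫ ω, cexp ((t * R ω : ℝ) * I) ∂P - ∫ ω, cexp ((t * W ω : ℝ) * I) ∂P‖
      ≤ (∫ ω, N ω ∂P) * |t| := by
    rw [← integral_sub hER hEW, ← integral_mul_const]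
    refine norm_integral_le_of_norm_le (hN.mul_const _) (Eventually.of_forall fun ω => ?_)
    refine (norm_cexp_mul_I_sub_le _ _).trans_eq ?_
    rw [hWN, show t * R ω - t * (N ω + R ω) = -(N ω * t) by ring, abs_neg, abs_mul,
      abs_of_nonneg (hN0 ω)]
  have hp : 0 ≤ ∫ ω, X ω ∂P := integral_nonneg fun ω => (hXle ω).1
  calc _ = ‖(∫ ω, X ω * cexp ((t * W ω : ℝ) * I) ∂P
          - cexp (t * I) * ∫ ω, (X ω : ℂ) * cexp ((t * R ω : ℝ) * I) ∂P)
        + (∫ ω, X ω ∂P : ℝ) * cexp (t * I) *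
          (∫ ω, cexp ((t * R ω : ℝ) * I) ∂P - ∫ ω, cexp ((t * W ω : ℝ) * I) ∂P)‖ := by
        rw [hprod]
        congr 1
        ring
    _ ≤ (∫ ω, X ω * M ω ∂P) * |t| + (∫ ω, X ω ∂P) * 1 * ((∫ ω, N ω ∂P) * |t|) := by
        refine (norm_add_le _ _).trans (add_le_add h1 ?_)
        rw [norm_mul, norm_mul, norm_exp_ofReal_mul_I, norm_real, Real.norm_of_nonneg hp]
        gcongr
    _ = _ := by ring

open Complex in
/-- The characteristic function of a sum of dissociated indicators is close to that of the Poisson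
law with the same mean. -/
lemma Dissociated.norm_charFun_sub_le [IsProbabilityMeasure P] (hS : ∀ e ∈ S, ¬ e.IsDiag)
    (hmeas : ∀ e ∈ S, Measurable (D e)) (hval : ∀ e ∈ S, ∀ ω, D e ω = 0 ∨ D e ω = 1)
    (hdiss : Dissociated P S D) (t : ℝ) :
    ‖charFun (P.map fun ω => ∑ e ∈ S, D e ω) t
        - cexp ((∫ ω, ∑ e ∈ S, D e ω ∂P : ℝ) * (cexp (t * I) - 1))‖
      ≤ Real.exp (2 * ∫ ω, ∑ e ∈ S, D e ω ∂P) * (adjacentPairSum P S D +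
        2 * ((pairSupport S).card * ∑ e ∈ S, (∫ ω, D e ω ∂P) ^ 2)) * |t| * |t| := by
  set W : Ω → ℝ := fun ω => ∑ e ∈ S, D e ω with hWdef
  have hsub (e : Sym2 V) : meetingPairs S e ⊆ S := Finset.filter_subset _ _
  have hnn (e : Sym2 V) (he : e ∈ S) (ω : Ω) : 0 ≤ D e ω := by
    rcases hval e he ω with h | h <;> simp [h]
  have hint (e : Sym2 V) (he : e ∈ S) : Integrable (D e) P :=
    integrable_of_eq_zero_or_one (hmeas e he) (hval e he)
  have hint2 (e : Sym2 V) (he : e ∈ S) (f : Sym2 V) (hf : f ∈ S) :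
      Integrable (fun ω => D e ω * D f ω) P :=
    integrable_mul_of_eq_zero_or_one (hmeas e he) (hmeas f hf) (hval e he) (hval f hf)
  have hW : Measurable W := Finset.measurable_fun_sum _ hmeas
  have hW0 (ω : Ω) : 0 ≤ W ω := Finset.sum_nonneg fun e he => hnn e he ω
  have hWC (ω : Ω) : |W ω| ≤ S.card := by
    rw [abs_of_nonneg (hW0 ω)]
    calc W ω ≤ ∑ e ∈ S, (1 : ℝ) := Finset.sum_le_sum fun e he => by
          rcases hval e he ω with h | h <;> simp [h]
      _ = _ := by simp
  have hmean : ∫ ω, W ω ∂P = ∑ e ∈ S, ∫ ω, D e ω ∂P := integral_finsetSum _ hint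
  have hterm (e : Sym2 V) (he : e ∈ S) (s : ℝ) :
      ‖∫ ω, D e ω * cexp ((s * W ω : ℝ) * I) ∂P
        - (∫ ω, D e ω ∂P : ℝ) * cexp (s * I) * ∫ ω, cexp ((s * W ω : ℝ) * I) ∂P‖
      ≤ (∑ f ∈ (meetingPairs S e).erase e, ∫ ω, D e ω * D f ω ∂P
          + ∑ f ∈ meetingPairs S e, (∫ ω, D e ω ∂P) * ∫ ω, D f ω ∂P) * |s| := by
    have hE (f : Sym2 V) (hf : f ∈ (meetingPairs S e).erase e) : f ∈ S :=
      hsub e (Finset.mem_of_mem_erase hf)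
    have hXM : Integrable (fun ω => D e ω * ∑ f ∈ (meetingPairs S e).erase e, D f ω) P := by
      simp_rw [Finset.mul_sum]
      exact integrable_finsetSum _ fun f hf => hint2 e he f (hE f hf)
    refine (norm_integral_mul_cexp_sub_le (hmeas e he) (hval e he)
      (R := fun ω => ∑ f ∈ S \ meetingPairs S e, D f ω)
      (N := fun ω => ∑ f ∈ meetingPairs S e, D f ω)
      (M := fun ω => ∑ f ∈ (meetingPairs S e).erase e, D f ω)
      (Finset.measurable_fun_sum _ fun f hf => hmeas f (Finset.sdiff_subset hf)) hW
      (hdiss.indepFun_sum he) (integrable_finsetSum _ fun f hf => hint f (hsub e hf))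
      (fun ω => Finset.sum_nonneg fun f hf => hnn f (hsub e hf) ω)
      (fun ω => Finset.sum_nonneg fun f hf => hnn f (hE f hf) ω) hXM
      (fun ω => ?_) (fun ω => ?_) s).trans_eq ?_
    · rw [add_comm]
      exact (Finset.sum_sdiff (hsub e)).symm
    · exact (Finset.add_sum_erase _ (fun f => D f ω) (mem_meetingPairs_self he)).symm
    · simp_rw [Finset.mul_sum]
      rw [integral_finsetSum _ fun f hf => hint2 e he f (hE f hf),
        integral_finsetSum _ fun f hf => hint f (hsub e hf), Finset.mul_sum]
  have hchar (s : ℝ) : charFun (P.map W) s = ∫ ω, cexp ((s * W ω : ℝ) * I) ∂P := by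
    rw [charFun_apply_real, integral_map hW.aemeasurable
      (Measurable.aestronglyMeasurable (by fun_prop))]
    simp
  have hadj : ∑ e ∈ S, ∑ f ∈ (meetingPairs S e).erase e, ∫ ω, D e ω * D f ω ∂P
      ≤ adjacentPairSum P S D :=
    sum_sum_meetingPairs_erase_le hS (g := fun e f => ∫ ω, D e ω * D f ω ∂P)
      fun e he f hf => integral_nonneg fun ω => mul_nonneg (hnn e he ω) (hnn f hf ω)
  have hadj0 : 0 ≤ adjacentPairSum P S D :=
    (Finset.sum_nonneg fun e he => Finset.sum_nonneg fun f hf => integral_nonneg fun ω =>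
      mul_nonneg (hnn e he ω)
        (hnn f (hsub e (Finset.mem_of_mem_erase hf)) ω)).trans hadj
  rw [hchar]
  refine norm_sub_exp_le_of_hasDerivAt (f := fun s : ℝ => ∫ ω, cexp ((s * W ω : ℝ) * I) ∂P)
    (integral_nonneg hW0) (by positivity) (by simp)
    (hasDerivAt_integral_cexp_mul_I hW hWC) (fun s => ?_) t
  have hexpand : ∫ ω, I * (W ω * cexp ((s * W ω : ℝ) * I)) ∂P
      = I * ∑ e ∈ S, ∫ ω, D e ω * cexp ((s * W ω : ℝ) * I) ∂P := by
    rw [integral_const_mul, ← integral_finsetSum]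
    · congr 2 with ω
      rw [← Finset.sum_mul, hWdef]
      push_cast
      rfl
    · intro e he
      refine (hint e he).ofReal.mul_bdd (c := 1) (Measurable.aestronglyMeasurable (by fun_prop))
        (Eventually.of_forall fun ω => (norm_exp_ofReal_mul_I _).le)
  calc _ = ‖I * ∑ e ∈ S, (∫ ω, D e ω * cexp ((s * W ω : ℝ) * I) ∂P
        - (∫ ω, D e ω ∂P : ℝ) * cexp (s * I) * ∫ ω, cexp ((s * W ω : ℝ) * I) ∂P)‖ := by
        rw [hexpand, hmean, Finset.sum_sub_distrib, ← Finset.sum_mul, ← Finset.sum_mul]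
        push_cast
        ring_nf
    _ ≤ ∑ e ∈ S, (∑ f ∈ (meetingPairs S e).erase e, ∫ ω, D e ω * D f ω ∂P
          + ∑ f ∈ meetingPairs S e, (∫ ω, D e ω ∂P) * ∫ ω, D f ω ∂P) * |s| := by
        rw [norm_mul, norm_I, one_mul]
        exact norm_sum_le_of_le _ fun e he => hterm e he s
    _ ≤ _ := by
        rw [← Finset.sum_mul, Finset.sum_add_distrib]
        gcongr
        exact sum_sum_meetingPairs_mul_le S fun e => ∫ ω, D e ω ∂P

end OneSpace

/-! ### Passage to the limit -/

theorem mainTheorem2 {Ω V : ℕ → Type*} [∀ n, MeasurableSpace (Ω n)] [∀ n, DecidableEq (V n)]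
    (P : (n : ℕ) → Measure (Ω n)) [∀ n, IsProbabilityMeasure (P n)]
    (S : (n : ℕ) → Finset (Sym2 (V n)))
    (hS : ∀ n, ∀ e ∈ S n, ¬ e.IsDiag)
    (D : (n : ℕ) → Sym2 (V n) → Ω n → ℝ)
    (hmeas : ∀ n, ∀ e ∈ S n, Measurable (D n e))
    (hval : ∀ n, ∀ e ∈ S n, ∀ ω, D n e ω = 0 ∨ D n e ω = 1)
    (hdiss : ∀ n, Dissociated (P n) (S n) (D n))
    (lam : ℝ≥0)
    (hmean : Tendsto (fun n => ∫ ω, ∑ e ∈ S n, D n e ω ∂(P n)) atTop (𝓝 (lam : ℝ)))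
    (hvar : Tendsto (fun n => variance (fun ω => ∑ e ∈ S n, D n e ω) (P n)) atTop
      (𝓝 (lam : ℝ)))
    (hsq : Tendsto (fun n => ((pairSupport (S n)).card : ℝ) * ∑ e ∈ S n, (∫ ω, D n e ω ∂(P n)) ^ 2)
      atTop (𝓝 0))
    (hadj : Tendsto (fun n => adjacentPairSum (P n) (S n) (D n)) atTop (𝓝 0)) :
    TendstoInDistribution (fun n ω => ∑ e ∈ S n, D n e ω) atTop (fun k : ℕ => (k : ℝ)) P
      (poissonMeasure lam) := by
  have hW (n : ℕ) : Measurable fun ω => ∑ e ∈ S n, D n e ω :=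
    Finset.measurable_fun_sum _ (hmeas n)
  refine ⟨fun n => (hW n).aemeasurable, Measurable.of_discrete.aemeasurable, ?_⟩
  refine ProbabilityMeasure.tendsto_iff_tendsto_charFun.2 fun t => ?_
  have hlim : Tendsto (fun n => Complex.exp ((∫ ω, ∑ e ∈ S n, D n e ω ∂(P n) : ℝ) *
      (Complex.exp (t * Complex.I) - 1))) atTop
      (𝓝 (charFun ((poissonMeasure lam).map fun k : ℕ => (k : ℝ)) t)) := by
    rw [charFun_map_cast_poissonMeasure]
    exact (((Complex.continuous_ofReal.tendsto _).comp hmean).mul_const _).cexp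
  have herr : Tendsto (fun n => Real.exp (2 * ∫ ω, ∑ e ∈ S n, D n e ω ∂(P n)) *
      (adjacentPairSum (P n) (S n) (D n) + 2 * ((pairSupport (S n)).card *
        ∑ e ∈ S n, (∫ ω, D n e ω ∂(P n)) ^ 2)) * |t| * |t|) atTop (𝓝 0) := by
    simpa using ((((hmean.const_mul 2).rexp).mul (hadj.add (hsq.const_mul 2))).mul_const
      |t|).mul_const |t|
  have hdiff := squeeze_zero_norm
    (fun n => (hdiss n).norm_charFun_sub_le (hS n) (hmeas n) (hval n) t) herr
  simpa using hdiff.add hlim
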